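/- Let $X$ and $Y$ be real Banach spaces with topological duals $X^*$, $Y^*$, let $A:X\to Y$ be a continuous linear operator with adjoint $A^\top:Y^*\to X^*$, $A^\top y^*=y^*\circ A$, and let $M:X\rightrightarrows X^*$ and $N:Y\rightrightarrows Y^*$ be maximal monotone operators (that is, monotone, and maximal with respect to graph inclusion among the monotone operators). Here $T:X\rightrightarrows X^*$ is monotone if $\langle x_1-x_2,x_1^*-x_2^*\rangle\ge 0$ for all $x_1^*\in T(x_1)$, $x_2^*\in T(x_2)$, and $\operatorname{dom}T=\{x : T(x)\neq\emptyset\}$. Put $C:=\operatorname{conv}\bigl(\operatorname{dom}N-A(\operatorname{dom}M)\bigr)\subset Y$, and suppose that the affine hull $\operatorname{aff}C$ is closed in $Y$ and that $0$ belongs to the relative algebraic interior of $C$, that is, $0\in C$ and for every $y\in\operatorname{aff}C$ there is $\delta>0$ such that $ty\in C$ for all $t\in[0,\delta]$. Let $M+A^\top NA:X\rightrightarrows X^*$ be the operator $x\mapsto\{x^*+A^\top y^* : x^*\in M(x),\ y^*\in N(Ax)\}$. Then $M+A^\top NA$ is maximal monotone if and only if it is unique, that is, it is monotone and has exactly one maximal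 monotone extension $S:X\rightrightarrows X^*$ (extension in the sense of graph inclusion). -/

import Mathlib

open scoped Pointwise

/-- A multifunction `T : X ⇉ X*` on a real normed space, `T x` being the set of values at `x`.
The order `T ≤ S` (pointwise inclusion of the value sets) is inclusion of graphs. -/
abbrev MultiOp (X : Type*) [NormedAddCommGroup X] [NormedSpace ℝ X] : Type _ :=
  X → Set (StrongDual ℝ X)

namespace MultiOp

variable {X Y : Type*} [NormedAddCommGroup X] [NormedSpace ℝ X]
  [NormedAddCommGroup Y] [NormedSpace ℝ Y]

/-- The domain `{x | T x ≠ ∅}`. -/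
def dom (T : MultiOp X) : Set X := {x | (T x).Nonempty}

/-- Monotonicity: `⟨x₁ - x₂, x₁* - x₂*⟩ ≥ 0` for all `x₁* ∈ T x₁`, `x₂* ∈ T x₂`. -/
def IsMonotone (T : MultiOp X) : Prop :=
  ∀ ⦃x₁ x₂ : X⦄ ⦃u₁ u₂ : StrongDual ℝ X⦄, u₁ ∈ T x₁ → u₂ ∈ T x₂ → 0 ≤ (u₁ - u₂) (x₁ - x₂)

/-- Maximal monotonicity, with respect to graph inclusion. -/
def IsMaximalMonotone (T : MultiOp X) : Prop := Maximal IsMonotone T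

/-- `T` is unique: it is monotone and has exactly one maximal monotone extension. -/
def IsUnique (T : MultiOp X) : Prop :=
  IsMonotone T ∧ ∃! S : MultiOp X, IsMaximalMonotone S ∧ T ≤ S

/-- The operator `Aᵀ N A : X ⇉ X*`, where `Aᵀ y* = y* ∘ A` is the adjoint of `A`. -/
def conjugateBy (A : X →L[ℝ] Y) (N : MultiOp Y) : MultiOp X :=
  fun x => (fun v : StrongDual ℝ Y => v.comp A) '' N (A x)

end MultiOp

/-- The relative algebraic interior `ⁱC` of `C`, with respect to its affine hull: the points
`a ∈ C` from which one can move inside `C` a little towards every point of `aff C`. -/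
def relAlgInterior {E : Type*} [AddCommGroup E] [Module ℝ E] (C : Set E) : Set E :=
  {a | a ∈ C ∧ ∀ x ∈ affineSpan ℝ C, ∃ δ > (0 : ℝ), ∀ t ∈ Set.Icc 0 δ, a + t • (x - a) ∈ C}

/-- The set `ⁱᶜC`, which is `ⁱC` if the affine hull of `C` is closed and is empty otherwise. -/
def closedRelAlgInterior {E : Type*} [AddCommGroup E] [Module ℝ E] [TopologicalSpace E]
    (C : Set E) : Set E :=
  {a | IsClosed (affineSpan ℝ C : Set E) ∧ a ∈ relAlgInterior C}

/-! Maximality gives uniqueness at once. Conversely, let T = M + AᵀNA be unique and (x, x')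
monotonically related to T. Fitzpatrick bounds for M and N add up to bounds for T that dominate the
pairing. If such a bound violated the Fenchel-Young inequality with (x, x'), a point of the segment
joining the two data would also be related to T, yet pair negatively with (x, x'), against
uniqueness (`IsUnique.pairing_le`).

The inequality says that a convex perturbation function of y = v - A u is nonnegative at y = 0.
Interiority and Baire bound it above near 0 in aff C (`exists_ball_bounded_fitzpatrickLE`), so it
has a continuous linear minorant there, extended to g on Y by Hahn-Banach. Then x' = (x' - g ∘ A) +
g ∘ A splits x' into elements of M x and AᵀN(A x) (`mem_add_conjugateBy_of_pairing_le`). -/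

/-! ### Open mapping for bounded closed convex sets -/

/-- If `0` and the points near `0` are approximated by the image of a bounded closed convex set,
then a neighbourhood of `0` is contained in that image. -/
theorem ball_subset_image_of_ball_subset_closure_image {E F : Type*}
    [NormedAddCommGroup E] [NormedSpace ℝ E] [CompleteSpace E]
    [NormedAddCommGroup F] [NormedSpace ℝ F]
    (G : E →L[ℝ] F) {K : Set E} (hKc : IsClosed K) (hKv : Convex ℝ K)
    (hKb : Bornology.IsBounded K) {ε : ℝ} (hε : 0 < ε)
    (h : Metric.ball (0 : F) ε ⊆ closure (G '' K)) :
    Metric.ball (0 : F) (ε / 2) ⊆ G '' K := by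
  intro y hy
  rw [mem_ball_zero_iff] at hy
  have step : ∀ z : F, ∃ κ : E, ‖z‖ < ε / 2 → κ ∈ K ∧ ‖(2 : ℝ) • z - G κ‖ < ε / 2 := by
    intro z
    by_cases hz : ‖z‖ < ε / 2
    · have h2 : (2 : ℝ) • z ∈ Metric.ball (0 : F) ε := by
        rw [mem_ball_zero_iff, norm_smul]
        norm_num
        linarith
      obtain ⟨_, ⟨κ, hκ, rfl⟩, hd⟩ := Metric.mem_closure_iff.1 (h h2) (ε / 2) (by linarith)
      exact ⟨κ, fun _ => ⟨hκ, by rwa [dist_eq_norm] at hd⟩⟩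
    · exact ⟨0, fun h => absurd h hz⟩
  choose κ hκ using step
  -- Rescaled remainders: y is the sum of 2^-(i+1) G(k i) over i < n, plus 2^-n r n.
  let r : ℕ → F := fun n => Nat.rec y (fun _ z => (2 : ℝ) • z - G (κ z)) n
  have r_succ : ∀ n, r (n + 1) = (2 : ℝ) • r n - G (κ (r n)) := fun n => rfl
  have hr : ∀ n, ‖r n‖ < ε / 2 := by
    intro n
    induction n with
    | zero => exact hy
    | succ n ih => rw [r_succ]; exact (hκ _ ih).2
  let k : ℕ → E := fun n => κ (r n)
  have hk : ∀ n, k n ∈ K := fun n => (hκ _ (hr n)).1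
  obtain ⟨B, hB⟩ := hKb.exists_norm_le
  have hgeo : Summable fun n : ℕ => (1 / 2 : ℝ) ^ (n + 1) := by
    simpa [pow_succ] using (summable_geometric_two.mul_right (1 / 2 : ℝ))
  have hsum : Summable fun n : ℕ => (1 / 2 : ℝ) ^ (n + 1) • k n := by
    refine Summable.of_norm_bounded (hgeo.mul_right B) fun n => ?_
    rw [norm_smul, Real.norm_of_nonneg (by positivity)]
    exact mul_le_mul_of_nonneg_left (hB _ (hk n)) (by positivity)
  have hlim := hsum.hasSum.tendsto_sum_nat
  -- `K` need not contain 0, so the missing weight 2^-n is put on `k 0`; it vanishes in the limit.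
  have partial_mem : ∀ n : ℕ,
      ∑ i ∈ Finset.range n, (1 / 2 : ℝ) ^ (i + 1) • k i + (1 / 2 : ℝ) ^ n • k 0 ∈ K := by
    intro n
    have hs : ∑ i ∈ Finset.range n, (1 / 2 : ℝ) ^ (i + 1) + (1 / 2 : ℝ) ^ n = 1 := by
      induction n with
      | zero => simp
      | succ n ih => rw [Finset.sum_range_succ, pow_succ]; linarith
    have := hKv.sum_mem (t := Finset.range (n + 1))
      (w := fun i => if i = n then (1 / 2 : ℝ) ^ n else (1 / 2 : ℝ) ^ (i + 1))
      (z := fun i => if i = n then k 0 else k i)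
      (fun i _ => by split_ifs <;> positivity)
      (by
        rw [Finset.sum_range_succ, if_pos rfl]
        refine Eq.trans (congrArg (· + _) ?_) hs
        exact Finset.sum_congr rfl fun i hi => if_neg (Finset.mem_range.1 hi).ne)
      (fun i _ => by split_ifs; exacts [hk 0, hk i])
    rw [Finset.sum_range_succ, if_pos rfl, if_pos rfl] at this
    convert this using 2
    exact Finset.sum_congr rfl fun i hi => by
      rw [if_neg (Finset.mem_range.1 hi).ne, if_neg (Finset.mem_range.1 hi).ne]
  have hpow : Filter.Tendsto (fun n : ℕ => (1 / 2 : ℝ) ^ n) Filter.atTop (nhds 0) :=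
    tendsto_pow_atTop_nhds_zero_of_lt_one (by norm_num) (by norm_num)
  have hmem : ∑' n : ℕ, (1 / 2 : ℝ) ^ (n + 1) • k n ∈ K := by
    refine hKc.mem_of_tendsto (b := Filter.atTop) (f := fun n : ℕ =>
      ∑ i ∈ Finset.range n, (1 / 2 : ℝ) ^ (i + 1) • k i + (1 / 2 : ℝ) ^ n • k 0) ?_
      (Filter.Eventually.of_forall partial_mem)
    simpa using hlim.add (hpow.smul_const (k 0))
  refine ⟨_, hmem, ?_⟩
  have hG : ∀ n : ℕ, G (∑ i ∈ Finset.range n, (1 / 2 : ℝ) ^ (i + 1) • k i)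
      = y - (1 / 2 : ℝ) ^ n • r n := by
    intro n
    induction n with
    | zero => simp [r]
    | succ n ih =>
      rw [Finset.sum_range_succ, map_add, ih, map_smul, r_succ, smul_sub, smul_smul, pow_succ,
        mul_assoc]
      norm_num
      abel
  have h0 : Filter.Tendsto (fun n : ℕ => (1 / 2 : ℝ) ^ n • r n) Filter.atTop (nhds 0) := by
    refine squeeze_zero_norm (a := fun n : ℕ => (1 / 2 : ℝ) ^ n * (ε / 2)) (fun n => ?_)
      (by simpa using hpow.mul_const (ε / 2))
    rw [norm_smul, Real.norm_of_nonneg (by positivity)]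
    exact mul_le_mul_of_nonneg_left (hr n).le (by positivity)
  refine tendsto_nhds_unique ((G.continuous.tendsto _).comp hlim) ?_
  have : Filter.Tendsto (fun n : ℕ => y - (1 / 2 : ℝ) ^ n • r n) Filter.atTop (nhds (y - 0)) :=
    tendsto_const_nhds.sub h0
  rw [sub_zero] at this
  exact this.congr fun n => (hG n).symm

/-- An open mapping theorem for an increasing sequence of bounded closed convex sets whose images
under a continuous linear map absorb a Banach space. -/
theorem exists_ball_subset_image_of_absorbing {E F : Type*}
    [NormedAddCommGroup E] [NormedSpace ℝ E] [CompleteSpace E]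
    [NormedAddCommGroup F] [NormedSpace ℝ F] [CompleteSpace F]
    (G : E →L[ℝ] F) {K : ℕ → Set E} (hKm : Monotone K) (hKc : ∀ k, IsClosed (K k))
    (hKv : ∀ k, Convex ℝ (K k)) (hKb : ∀ k, Bornology.IsBounded (K k))
    (h : ∀ y : F, ∃ δ > (0 : ℝ), ∀ t ∈ Set.Icc 0 δ, ∃ k, t • y ∈ G '' K k) :
    ∃ k, ∃ ε > (0 : ℝ), Metric.ball (0 : F) ε ⊆ G '' K k := by
  have hcover : (⋃ p : ℕ × ℕ, {y : F | (1 / ((p.1 : ℝ) + 1)) • y ∈ closure (G '' K p.2)})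
      = Set.univ := by
    refine Set.eq_univ_of_forall fun y => ?_
    obtain ⟨δ, hδ, hy⟩ := h y
    obtain ⟨n, hn⟩ := exists_nat_one_div_lt hδ
    obtain ⟨k, hk⟩ := hy _ ⟨by positivity, hn.le⟩
    exact Set.mem_iUnion.2 ⟨(n, k), subset_closure hk⟩
  obtain ⟨⟨n, k⟩, y₀, hy₀⟩ := nonempty_interior_of_iUnion_of_closed
    (fun p : ℕ × ℕ => isClosed_closure.preimage (continuous_const_smul (1 / ((p.1 : ℝ) + 1))))
    hcover
  obtain ⟨ρ, hρ, hball⟩ := Metric.mem_nhds_iff.1 (mem_interior_iff_mem_nhds.1 hy₀)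
  set c : ℝ := 1 / ((n : ℝ) + 1) with hc
  have hc0 : 0 < c := by positivity
  -- A ball around `c • y₀` is moved to the origin by averaging with `-(s * c) • y₀`, with weights
  -- s/(1+s) and 1/(1+s).
  obtain ⟨s, hs, hs'⟩ := h (-(c • y₀))
  obtain ⟨j, hj⟩ := hs' s ⟨hs.le, le_rfl⟩
  have hmono : ∀ {a b}, a ≤ b → closure (G '' K a) ⊆ closure (G '' K b) := fun hab =>
    closure_mono (Set.image_mono (hKm hab))
  have hconv : Convex ℝ (closure (G '' K (max k j))) :=
    ((hKv _).linear_image G.toLinearMap).closure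
  refine ⟨max k j, _, ?_, ball_subset_image_of_ball_subset_closure_image G (hKc _) (hKv _) (hKb _)
    (ε := c * ρ * (s / (1 + s))) (by positivity) ?_⟩
  · positivity
  · intro y hy
    rw [mem_ball_zero_iff] at hy
    have h1 : c • y₀ + ((1 + s) / s) • y ∈ closure (G '' K (max k j)) := by
      have hb : y₀ + (c⁻¹ * ((1 + s) / s)) • y ∈ Metric.ball y₀ ρ := by
        rw [mem_ball_iff_norm, add_sub_cancel_left, norm_smul,
          Real.norm_of_nonneg (by positivity)]
        calc c⁻¹ * ((1 + s) / s) * ‖y‖ < c⁻¹ * ((1 + s) / s) * (c * ρ * (s / (1 + s))) :=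
              mul_lt_mul_of_pos_left hy (by positivity)
          _ = ρ := by field_simp
      have := hball hb
      simp only [Set.mem_preimage, smul_add, smul_smul] at this
      rw [← mul_assoc, mul_inv_cancel₀ hc0.ne', one_mul] at this
      exact hmono (le_max_left _ _) this
    have h2 := hmono (le_max_right k j) (subset_closure hj)
    have := hconv h1 h2 (a := s / (1 + s)) (b := 1 / (1 + s)) (by positivity) (by positivity)
      (by field_simp; ring)
    convert this using 1
    rw [smul_add, smul_smul, smul_neg, smul_neg, smul_smul, smul_smul, smul_smul]
    have e1 : s / (1 + s) * ((1 + s) / s) = 1 := by field_simp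
    have e2 : 1 / (1 + s) * s * c = s / (1 + s) * c := by ring
    rw [e1, one_smul, e2]
    abel

/-! ### Related points, uniqueness and Fitzpatrick bounds -/

namespace MultiOp

variable {X Y : Type*} [NormedAddCommGroup X] [NormedSpace ℝ X]
  [NormedAddCommGroup Y] [NormedSpace ℝ Y]

/-- `(x, u)` is monotonically related to the graph of `T`. -/
def IsRelated (T : MultiOp X) (x : X) (u : StrongDual ℝ X) : Prop :=
  ∀ ⦃m : X⦄ ⦃v : StrongDual ℝ X⦄, v ∈ T m → 0 ≤ (u - v) (x - m)

/-- The Fitzpatrick function of `T` is at most `a` at `(x, u)`. -/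
def FitzpatrickLE (T : MultiOp X) (x : X) (u : StrongDual ℝ X) (a : ℝ) : Prop :=
  ∀ ⦃m : X⦄ ⦃v : StrongDual ℝ X⦄, v ∈ T m → v x + u m - v m ≤ a

theorem exists_isMaximalMonotone_ge {T : MultiOp X} (hT : T.IsMonotone) :
    ∃ S : MultiOp X, S.IsMaximalMonotone ∧ T ≤ S := by
  obtain ⟨S, hTS, hS⟩ := zorn_le_nonempty₀ {S : MultiOp X | S.IsMonotone}
    (fun c hc hchain _ _ => by
      refine ⟨fun x => ⋃ S ∈ c, S x, ?_, fun S hS x _ hu => Set.mem_biUnion hS hu⟩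
      intro x₁ x₂ u₁ u₂ h₁ h₂
      simp only [Set.mem_iUnion] at h₁ h₂
      obtain ⟨S₁, hS₁, h₁⟩ := h₁
      obtain ⟨S₂, hS₂, h₂⟩ := h₂
      rcases hchain.total hS₁ hS₂ with h | h
      · exact hc hS₂ (h x₁ h₁) h₂
      · exact hc hS₁ h₁ (h x₂ h₂)) T hT
  exact ⟨S, hS, hTS⟩

/-- A monotone graph stays monotone when a monotonically related point is added. -/
theorem IsMonotone.insert {T : MultiOp X} (hT : T.IsMonotone) {x : X} {u : StrongDual ℝ X}
    (h : T.IsRelated x u) : IsMonotone (fun y => T y ∪ {v | y = x ∧ v = u} : MultiOp X) := by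
  rintro x₁ x₂ u₁ u₂ (h₁ | ⟨rfl, rfl⟩) (h₂ | ⟨rfl, rfl⟩)
  · exact hT h₁ h₂
  · have := h h₁
    simp only [sub_apply, map_sub] at this ⊢
    linarith
  · exact h h₂
  · simp

theorem IsMaximalMonotone.mem_of_isRelated {T : MultiOp X} (hT : T.IsMaximalMonotone)
    {x : X} {u : StrongDual ℝ X} (h : T.IsRelated x u) : u ∈ T x :=
  hT.2 (hT.1.insert h) (fun _ => Set.subset_union_left) x (Or.inr ⟨rfl, rfl⟩)

theorem isMaximalMonotone_of_isRelated_mem {T : MultiOp X} (hT : T.IsMonotone)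
    (h : ∀ x u, T.IsRelated x u → u ∈ T x) : T.IsMaximalMonotone :=
  ⟨hT, fun _ hS hTS x _ hu => h x _ fun _ _ hv => hS hu (hTS _ hv)⟩

theorem IsMaximalMonotone.isUnique {T : MultiOp X} (hT : T.IsMaximalMonotone) : T.IsUnique :=
  ⟨hT.1, T, ⟨hT, le_rfl⟩, fun _ hS => le_antisymm (hT.2 hS.1.1 hS.2) hS.2⟩

/-- For a unique operator, the points monotonically related to it form a monotone graph. -/
theorem IsUnique.nonneg_of_isRelated {T : MultiOp X} (hT : T.IsUnique)
    {x₁ x₂ : X} {u₁ u₂ : StrongDual ℝ X} (h₁ : T.IsRelated x₁ u₁) (h₂ : T.IsRelated x₂ u₂) :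
    0 ≤ (u₁ - u₂) (x₁ - x₂) := by
  obtain ⟨hmono, S, ⟨hS, hTS⟩, huniq⟩ := hT
  have key : ∀ {x u}, T.IsRelated x u → u ∈ S x := by
    intro x u h
    obtain ⟨R, hR, hTR⟩ := exists_isMaximalMonotone_ge (hmono.insert h)
    rw [← huniq R ⟨hR, fun y => Set.subset_union_left.trans (hTR y)⟩]
    exact hTR x (Or.inr ⟨rfl, rfl⟩)
  exact hS.1 (key h₁) (key h₂)

theorem IsMonotone.fitzpatrickLE {T : MultiOp X} (hT : T.IsMonotone) {x : X}
    {u : StrongDual ℝ X} (hu : u ∈ T x) : T.FitzpatrickLE x u (u x) := by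
  intro m v hv
  have := hT hu hv
  simp only [sub_apply, map_sub] at this
  linarith

/-- A smaller bound would make (x, u) related to `T`, hence a graph point, and testing the bound
there is contradictory. -/
theorem IsMaximalMonotone.le_of_fitzpatrickLE {T : MultiOp X} (hT : T.IsMaximalMonotone)
    {x : X} {u : StrongDual ℝ X} {a : ℝ} (h : T.FitzpatrickLE x u a) : u x ≤ a := by
  by_contra! hlt
  have hu : u ∈ T x := hT.mem_of_isRelated fun m v hv => by
    have := h hv
    simp only [sub_apply, map_sub]
    linarith
  have := h hu
  linarith

theorem FitzpatrickLE.mono {T : MultiOp X} {x : X} {u : StrongDual ℝ X} {a b : ℝ}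
    (h : T.FitzpatrickLE x u a) (hab : a ≤ b) : T.FitzpatrickLE x u b :=
  fun _ _ hv => (h hv).trans hab

theorem FitzpatrickLE.convexCombo {T : MultiOp X} {x₁ x₂ : X} {u₁ u₂ : StrongDual ℝ X}
    {a₁ a₂ s t : ℝ} (h₁ : T.FitzpatrickLE x₁ u₁ a₁) (h₂ : T.FitzpatrickLE x₂ u₂ a₂)
    (hs : 0 ≤ s) (ht : 0 ≤ t) (hst : s + t = 1) :
    T.FitzpatrickLE (s • x₁ + t • x₂) (s • u₁ + t • u₂) (s * a₁ + t * a₂) := by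
  intro m v hv
  have e₁ := mul_le_mul_of_nonneg_left (h₁ hv) hs
  have e₂ := mul_le_mul_of_nonneg_left (h₂ hv) ht
  have e₃ : v m = s * v m + t * v m := by rw [← add_mul, hst, one_mul]
  simp only [map_add, map_smul, add_apply, smul_apply,
    smul_eq_mul]
  linarith

theorem isClosed_setOf_fitzpatrickLE (T : MultiOp X) (a : ℝ) :
    IsClosed {p : X × StrongDual ℝ X | T.FitzpatrickLE p.1 p.2 a} := by
  simp only [FitzpatrickLE, Set.ofPred_forall]
  refine isClosed_iInter fun m => isClosed_iInter fun v => isClosed_iInter fun _ => ?_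
  refine isClosed_le ?_ continuous_const
  exact ((v.continuous.comp continuous_fst).add
    ((ContinuousLinearMap.apply ℝ ℝ m).continuous.comp continuous_snd)).sub continuous_const

/-- A Fenchel-Young type inequality between a point monotonically related to a unique operator
and a point of the domain of its Fitzpatrick function where the latter dominates the pairing. -/
theorem IsUnique.pairing_le {T : MultiOp X} (hT : T.IsUnique) {x w : X}
    {u v : StrongDual ℝ X} {a : ℝ} (hx : T.IsRelated x u) (hw : T.FitzpatrickLE w v a)
    (ha : v w ≤ a) : u w + v x - u x ≤ a := by
  by_contra! hlt
  set q := (u - v) (x - w) with hq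
  have hqe : q = u x - u w - v x + v w := by
    simp only [hq, sub_apply, map_sub]; ring
  have hq0 : q < 0 := by linarith
  -- The pairing is quadratic, so along the segment its value against a graph point gains -t(1-t)q >
  -- 0 over the convex combination of the end values; for small t this outweighs the deficit t(a - v
  -- w).
  obtain ⟨t, ht0, ht1, ht⟩ : ∃ t : ℝ, 0 < t ∧ t ≤ 1 ∧ a ≤ v w - (1 - t) * q := by
    have hd : 0 < u w + v x - u x - a := by linarith
    refine ⟨min 1 ((u w + v x - u x - a) / (-q)), ?_, min_le_left _ _, ?_⟩
    · exact lt_min one_pos (div_pos hd (by linarith))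
    · have := mul_le_mul_of_nonneg_right
        (min_le_right 1 ((u w + v x - u x - a) / (-q))) (by linarith : 0 ≤ -q)
      rw [div_mul_cancel₀ _ (neg_pos.2 hq0).ne'] at this
      linarith
  have hrel : T.IsRelated ((1 - t) • x + t • w) ((1 - t) • u + t • v) := by
    intro m τ hτ
    have e₁ := mul_nonneg (sub_nonneg.2 ht1) (hx hτ)
    have e₂ := mul_le_mul_of_nonneg_left ((hw hτ).trans ht) ht0.le
    rw [hqe] at e₂
    simp only [map_add, map_sub, map_smul, add_apply,
      sub_apply, smul_apply, smul_eq_mul] at e₁ ⊢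
    nlinarith
  have := hT.nonneg_of_isRelated hx hrel
  have e : (u - ((1 - t) • u + t • v)) (x - ((1 - t) • x + t • w)) = t ^ 2 * q := by
    rw [hqe]
    simp only [map_add, map_sub, map_smul, add_apply,
      sub_apply, smul_apply, smul_eq_mul]
    ring
  rw [e] at this
  nlinarith [pow_pos ht0 2]

theorem FitzpatrickLE.add_conjugateBy {A : X →L[ℝ] Y} {M : MultiOp X} {N : MultiOp Y} {x : X}
    {u : StrongDual ℝ X} {v : StrongDual ℝ Y} {a b : ℝ} (hM : M.FitzpatrickLE x u a)
    (hN : N.FitzpatrickLE (A x) v b) :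
    FitzpatrickLE (fun x => M x + conjugateBy A N x) x (u + v.comp A) (a + b) := by
  rintro m _ ⟨μ, hμ, _, ⟨ν, hν, rfl⟩, rfl⟩
  have e₁ := hM hμ
  have e₂ := hN hν
  simp only [add_apply, ContinuousLinearMap.comp_apply]
  linarith

end MultiOp

/-! ### Supporting functional at the origin -/

/-- A convex upward closed set in `F × ℝ` that lies above `0` over the origin and is bounded
above near the origin has a supporting continuous linear functional at the origin. -/
theorem exists_continuousLinearMap_le_of_convex {F : Type*} [NormedAddCommGroup F]
    [NormedSpace ℝ F] {W : Set (F × ℝ)} (hW : Convex ℝ W)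
    (hup : ∀ y r r', (y, r) ∈ W → r ≤ r' → (y, r') ∈ W) {ε R : ℝ} (hε : 0 < ε)
    (hball : ∀ y ∈ Metric.ball (0 : F) ε, (y, R) ∈ W) (h0 : ∀ r, ((0 : F), r) ∈ W → 0 ≤ r) :
    ∃ f : StrongDual ℝ F, ∀ y r, (y, r) ∈ W → f y ≤ r := by
  have hsub : Metric.ball (0 : F) ε ×ˢ Set.Ioi R ⊆ interior W :=
    interior_maximal (fun p hp => hup _ _ _ (hball _ hp.1) (le_of_lt hp.2))
      (Metric.isOpen_ball.prod isOpen_Ioi)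
  have hR : ((0 : F), R + 1) ∈ interior W := hsub ⟨Metric.mem_ball_self hε, by simp⟩
  have hnot : (0 : F × ℝ) ∉ interior W := by
    intro h
    obtain ⟨δ, hδ, hb⟩ := Metric.mem_nhds_iff.1 (mem_interior_iff_mem_nhds.1 h)
    have : ((0 : F), -(δ / 2)) ∈ W := hb (by
      rw [mem_ball_zero_iff, Prod.norm_mk, norm_zero, norm_neg, Real.norm_of_nonneg (by linarith)]
      exact max_lt hδ (by linarith))
    linarith [h0 _ this]
  obtain ⟨f, hf⟩ := geometric_hahn_banach_open_point hW.interior isOpen_interior hnot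
  rw [map_zero] at hf
  have hle : ∀ p ∈ W, f p ≤ 0 := by
    intro p hp
    have hcl : p ∈ closure (interior W) := by
      rw [hW.closure_interior_eq_closure_of_nonempty_interior ⟨_, hR⟩]
      exact subset_closure hp
    exact closure_minimal (fun q hq => (hf q hq).le)
      (isClosed_le f.continuous continuous_const) hcl
  have hsplit : ∀ y r, f (y, r) = f (y, 0) + r * f (0, 1) := by
    intro y r
    rw [← smul_eq_mul, ← map_smul, ← map_add]
    simp
  have hneg : f ((0 : F), (1 : ℝ)) < 0 := by
    have h1 := hf _ hR
    -- `R` may be negative; a point of positive height is needed to read off the sign of f (0, 1).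
    have h2 := hf ((0 : F), max (R + 1) 1) (hsub ⟨Metric.mem_ball_self hε,
      (lt_add_one R).trans_le (le_max_left _ _)⟩)
    rw [hsplit, Prod.mk_zero_zero, map_zero, zero_add] at h2
    exact neg_of_mul_neg_right h2 (by positivity)
  refine ⟨(-f (0, 1))⁻¹ • f.comp (ContinuousLinearMap.inl ℝ F ℝ), fun y r hyr => ?_⟩
  have := hle _ hyr
  rw [hsplit] at this
  simp only [smul_apply, ContinuousLinearMap.comp_apply,
    ContinuousLinearMap.inl_apply, smul_eq_mul]
  rw [inv_mul_le_iff₀ (by linarith)]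
  linarith

/-! ### The interiority condition and the decomposition of x' -/

namespace MultiOp

variable {X Y : Type*} [NormedAddCommGroup X] [NormedSpace ℝ X]
  [NormedAddCommGroup Y] [NormedSpace ℝ Y]

/-- Fitzpatrick bounds, unlike graph points, survive convex combinations. -/
theorem exists_fitzpatrickLE_of_mem_convexHull {A : X →L[ℝ] Y} {M : MultiOp X} {N : MultiOp Y}
    (hM : M.IsMonotone) (hN : N.IsMonotone) {y : Y}
    (hy : y ∈ convexHull ℝ (N.dom - A '' M.dom)) :
    ∃ (u : X) (u' : StrongDual ℝ X) (v : Y) (v' : StrongDual ℝ Y) (a b : ℝ),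
      M.FitzpatrickLE u u' a ∧ N.FitzpatrickLE v v' b ∧ v - A u = y := by
  refine convexHull_min (t := {y | ∃ (u : X) (u' : StrongDual ℝ X) (v : Y)
    (v' : StrongDual ℝ Y) (a b : ℝ),
      M.FitzpatrickLE u u' a ∧ N.FitzpatrickLE v v' b ∧ v - A u = y}) ?_ ?_ hy
  · rintro _ ⟨v, ⟨v', hv⟩, _, ⟨u, ⟨u', hu⟩, rfl⟩, rfl⟩
    exact ⟨u, u', v, v', _, _, hM.fitzpatrickLE hu, hN.fitzpatrickLE hv, rfl⟩
  · rintro _ ⟨u₁, u₁', v₁, v₁', a₁, b₁, hu₁, hv₁, rfl⟩ _ ⟨u₂, u₂', v₂, v₂', a₂, b₂, hu₂, hv₂, rfl⟩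
      s t hs ht hst
    refine ⟨_, _, _, _, _, _, hu₁.convexCombo hu₂ hs ht hst, hv₁.convexCombo hv₂ hs ht hst, ?_⟩
    simp only [map_add, map_smul, smul_sub]
    abel

/-- Points of the Fitzpatrick domains of `M` and `N`, with bounded data, fill a ball of the
subspace in which `0` is an algebraic interior point of `conv (dom N - A (dom M))`. -/
theorem exists_ball_bounded_fitzpatrickLE [CompleteSpace X] [CompleteSpace Y]
    {A : X →L[ℝ] Y} {M : MultiOp X} {N : MultiOp Y}
    (hM : M.IsMonotone) (hN : N.IsMonotone) {V : Submodule ℝ Y} (hV : IsClosed (V : Set Y))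
    (h : ∀ y ∈ V, ∃ δ > (0 : ℝ), ∀ t ∈ Set.Icc 0 δ,
      t • y ∈ convexHull ℝ (N.dom - A '' M.dom)) :
    ∃ (k : ℝ), ∃ ε > (0 : ℝ), ∀ y ∈ V, ‖y‖ < ε →
      ∃ (u : X) (u' : StrongDual ℝ X) (v : Y) (v' : StrongDual ℝ Y),
      M.FitzpatrickLE u u' k ∧ N.FitzpatrickLE v v' k ∧ v - A u = y ∧
      ‖u‖ ≤ k ∧ ‖u'‖ ≤ k ∧ ‖v'‖ ≤ k := by
  let G₀ : (X × StrongDual ℝ X) × (Y × StrongDual ℝ Y) →L[ℝ] Y :=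
    (ContinuousLinearMap.fst ℝ Y (StrongDual ℝ Y)).comp (ContinuousLinearMap.snd ℝ _ _) -
      A.comp ((ContinuousLinearMap.fst ℝ X (StrongDual ℝ X)).comp (ContinuousLinearMap.fst ℝ _ _))
  have hG₀ : ∀ p, G₀ p = p.2.1 - A p.1.1 := fun _ => rfl
  -- Restricting to data with v - A u in `V` makes the closed subspace `V` the Banach target.
  let E : Submodule ℝ ((X × StrongDual ℝ X) × (Y × StrongDual ℝ Y)) := V.comap G₀.toLinearMap
  have hE : IsClosed (E : Set ((X × StrongDual ℝ X) × (Y × StrongDual ℝ Y))) :=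
    hV.preimage G₀.continuous
  have : CompleteSpace E := hE.completeSpace_coe
  have : CompleteSpace V := hV.completeSpace_coe
  let G : E →L[ℝ] V := (G₀.comp E.subtypeL).codRestrict V fun p => p.2
  let K : ℕ → Set E := fun k => {p | M.FitzpatrickLE p.1.1.1 p.1.1.2 k ∧
    N.FitzpatrickLE p.1.2.1 p.1.2.2 k ∧ p ∈ Metric.closedBall 0 (k : ℝ)}
  obtain ⟨k, ε, hε, hk⟩ := exists_ball_subset_image_of_absorbing G (K := K)
    (fun a b hab p hp => by
      have : (a : ℝ) ≤ b := by exact_mod_cast hab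
      exact ⟨hp.1.mono this, hp.2.1.mono this, Metric.closedBall_subset_closedBall this hp.2.2⟩)
    (fun k => by
      refine ((M.isClosed_setOf_fitzpatrickLE k).preimage
        (continuous_fst.comp continuous_subtype_val)).inter
        (((N.isClosed_setOf_fitzpatrickLE k).preimage
        (continuous_snd.comp continuous_subtype_val)).inter
        Metric.isClosed_closedBall))
    (fun k p hp q hq s t hs ht hst => by
      have e : s * (k : ℝ) + t * k = k := by rw [← add_mul, hst, one_mul]
      refine ⟨e ▸ hp.1.convexCombo hq.1 hs ht hst, e ▸ hp.2.1.convexCombo hq.2.1 hs ht hst,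
        convex_closedBall (0 : E) (k : ℝ) hp.2.2 hq.2.2 hs ht hst⟩)
    (fun k => (Metric.isBounded_closedBall (x := (0 : E)) (r := k)).subset fun p hp => hp.2.2)
    (fun y => by
      obtain ⟨δ, hδ, hy⟩ := h y y.2
      refine ⟨δ, hδ, fun t ht => ?_⟩
      obtain ⟨u, u', v, v', a, b, hu, hv, huv⟩ :=
        exists_fitzpatrickLE_of_mem_convexHull hM hN (hy t ht)
      have hmem : ((u, u'), (v, v')) ∈ E := by
        change v - A u ∈ V
        rw [huv]
        exact V.smul_mem t y.2
      let p : E := ⟨((u, u'), (v, v')), hmem⟩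
      obtain ⟨k, hk⟩ := exists_nat_ge (max a (max b (dist p 0)))
      simp only [max_le_iff] at hk
      exact ⟨k, p, ⟨hu.mono hk.1, hv.mono hk.2.1, hk.2.2⟩, Subtype.ext huv⟩)
  refine ⟨k, ε, hε, fun y hy hyε => ?_⟩
  obtain ⟨p, ⟨hp₁, hp₂, hp₃⟩, hpy⟩ := @hk ⟨y, hy⟩ (by simpa using hyε)
  have hp : ‖(p : (X × StrongDual ℝ X) × (Y × StrongDual ℝ Y))‖ ≤ k :=
    (dist_zero_right p).symm.trans_le hp₃
  have h₁ := (norm_fst_le _).trans hp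
  have h₂ := (norm_snd_le _).trans hp
  exact ⟨_, _, _, _, hp₁, hp₂, congrArg Subtype.val hpy, (norm_fst_le _).trans h₁,
    (norm_snd_le _).trans h₁, (norm_snd_le _).trans h₂⟩

/-- Under the interiority condition, a point where the pairing inequality holds for all points of
the Fitzpatrick domains belongs to the graph of `M + Aᵀ N A`. -/
theorem mem_add_conjugateBy_of_pairing_le [CompleteSpace X] [CompleteSpace Y]
    {A : X →L[ℝ] Y} {M : MultiOp X} {N : MultiOp Y}
    (hM : M.IsMaximalMonotone) (hN : N.IsMaximalMonotone)
    (h0 : (0 : Y) ∈ closedRelAlgInterior (convexHull ℝ (N.dom - A '' M.dom)))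
    {x : X} {x' : StrongDual ℝ X}
    (h : ∀ (u : X) (u' : StrongDual ℝ X) (v' : StrongDual ℝ Y) (a b : ℝ),
      M.FitzpatrickLE u u' a → N.FitzpatrickLE (A u) v' b →
        x' u + (u' x + v' (A x)) - x' x ≤ a + b) :
    x' ∈ M x + conjugateBy A N x := by
  obtain ⟨hcl, h0C, h0i⟩ := h0
  set C := convexHull ℝ (N.dom - A '' M.dom) with hC
  have h0a : (0 : Y) ∈ affineSpan ℝ C := subset_affineSpan ℝ C h0C
  set V : Submodule ℝ Y := (affineSpan ℝ C).direction with hVdef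
  have hmemV : ∀ y, y ∈ V ↔ y ∈ affineSpan ℝ C := fun y => by
    simpa using AffineSubspace.vsub_right_mem_direction_iff_mem h0a y
  have hV : IsClosed (V : Set Y) := by
    convert hcl using 1
    exact Set.ext hmemV
  obtain ⟨k, ε, hε, hk⟩ := exists_ball_bounded_fitzpatrickLE (A := A) hM.1 hN.1 hV
    fun y hy => by simpa using h0i y ((hmemV y).1 hy)
  -- Encodes upper bounds of the perturbation function; `h` is its nonnegativity over 0.
  let W : Set (V × ℝ) := {p | ∃ (u : X) (u' : StrongDual ℝ X) (v : Y) (v' : StrongDual ℝ Y)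
    (a b : ℝ), M.FitzpatrickLE u u' a ∧ N.FitzpatrickLE v v' b ∧ v - A u = p.1 ∧
      a + b - (x' u + (u' x + v' (A x)) - x' x) ≤ p.2}
  have hW : Convex ℝ W := by
    rintro ⟨y₁, r₁⟩ ⟨u₁, u₁', v₁, v₁', a₁, b₁, hu₁, hv₁, hy₁, hr₁⟩
      ⟨y₂, r₂⟩ ⟨u₂, u₂', v₂, v₂', a₂, b₂, hu₂, hv₂, hy₂, hr₂⟩ s t hs ht hst
    refine ⟨_, _, _, _, _, _, hu₁.convexCombo hu₂ hs ht hst, hv₁.convexCombo hv₂ hs ht hst, ?_, ?_⟩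
    · simp only [Prod.fst_add, Prod.smul_fst, Submodule.coe_add, Submodule.coe_smul] at hy₁ hy₂ ⊢
      rw [← hy₁, ← hy₂]
      simp only [map_add, map_smul, smul_sub]
      abel
    · have e₁ := mul_le_mul_of_nonneg_left hr₁ hs
      have e₂ := mul_le_mul_of_nonneg_left hr₂ ht
      have e₃ : x' x = s * x' x + t * x' x := by rw [← add_mul, hst, one_mul]
      simp only [Prod.snd_add, Prod.smul_snd, map_add, map_smul, add_apply,
        smul_apply, smul_eq_mul] at e₁ e₂ ⊢
      linarith
  obtain ⟨f, hf⟩ := exists_continuousLinearMap_le_of_convex hW (ε := ε)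
    (R := k + k + (‖x'‖ * k + k * ‖x‖ + k * ‖A x‖ + x' x))
    (fun y r r' ⟨u, u', v, v', a, b, hu, hv, hy, hr⟩ hrr' =>
      ⟨u, u', v, v', a, b, hu, hv, hy, hr.trans hrr'⟩) hε
    (fun y hy => by
      obtain ⟨u, u', v, v', hu, hv, huv, hnu, hnu', hnv'⟩ := hk y y.2 (by simpa using hy)
      refine ⟨u, u', v, v', k, k, hu, hv, huv, ?_⟩
      have b₁ := (abs_le.1 (x'.le_of_opNorm_le_of_le le_rfl hnu)).1
      have b₂ := (abs_le.1 (u'.le_of_opNorm_le_of_le hnu' (le_refl ‖x‖))).1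
      have b₃ := (abs_le.1 (v'.le_of_opNorm_le_of_le hnv' (le_refl ‖A x‖))).1
      linarith)
    (fun r ⟨u, u', v, v', a, b, hu, hv, hy, hr⟩ => by
      have hv_eq : v = A u := sub_eq_zero.1 (by simpa using hy)
      subst hv_eq
      have := h u u' v' a b hu hv
      dsimp only at hr
      linarith)
  obtain ⟨g, hg, -⟩ := exists_extension_norm_eq V f
  have hpair : ∀ {m m' n n'}, m' ∈ M m → n' ∈ N n →
      0 ≤ (x' - g.comp A - m') (x - m) + (g - n') (A x - n) := by
    intro m m' n n' hm hn
    have hmem : n - A m ∈ V := (hmemV _).2 (subset_affineSpan ℝ C (subset_convexHull ℝ _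
      (Set.sub_mem_sub ⟨n', hn⟩ (Set.mem_image_of_mem A ⟨m', hm⟩))))
    have := hf ⟨n - A m, hmem⟩ _
      ⟨m, m', n, n', _, _, hM.1.fitzpatrickLE hm, hN.1.fitzpatrickLE hn, rfl, le_rfl⟩
    rw [← hg] at this
    simp only [map_sub, sub_apply, ContinuousLinearMap.comp_apply] at this ⊢
    linarith
  -- The two terms of `hpair` vary independently: if the first is ever negative, the second is
  -- always positive, so maximality of `M` or of `N` applies.
  have hNg : g ∈ N (A x) := by
    by_contra hng
    have hMg : x' - g.comp A ∈ M x := hM.mem_of_isRelated fun m m' hm => by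
      by_contra! hlt
      exact hng (hN.mem_of_isRelated fun n n' hn => by linarith [hpair hm hn])
    exact hng (hN.mem_of_isRelated fun n n' hn => by simpa using hpair hMg hn)
  have hMg : x' - g.comp A ∈ M x := hM.mem_of_isRelated fun m m' hm => by
    simpa using hpair hm hNg
  exact ⟨_, hMg, _, ⟨g, hNg, rfl⟩, sub_add_cancel _ _⟩

end MultiOp

theorem corollary3p9 {X Y : Type*}
    [NormedAddCommGroup X] [NormedSpace ℝ X] [CompleteSpace X]
    [NormedAddCommGroup Y] [NormedSpace ℝ Y] [CompleteSpace Y]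
    (A : X →L[ℝ] Y) (M : MultiOp X) (N : MultiOp Y)
    (hM : M.IsMaximalMonotone) (hN : N.IsMaximalMonotone)
    (h0 : (0 : Y) ∈ closedRelAlgInterior (convexHull ℝ (N.dom - A '' M.dom))) :
    MultiOp.IsMaximalMonotone (fun x => M x + MultiOp.conjugateBy A N x) ↔
      MultiOp.IsUnique (fun x => M x + MultiOp.conjugateBy A N x) := by
  refine ⟨MultiOp.IsMaximalMonotone.isUnique, fun hT =>
    MultiOp.isMaximalMonotone_of_isRelated_mem hT.1 fun x x' hx =>
      MultiOp.mem_add_conjugateBy_of_pairing_le hM hN h0 fun u u' v' a b hu hv => ?_⟩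
  have ha := hM.le_of_fitzpatrickLE hu
  have hb := hN.le_of_fitzpatrickLE hv
  exact hT.pairing_le hx (hu.add_conjugateBy hv) (add_le_add ha hb)
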